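/- A $0$-$1$ sequence is a map $\mu : I \to \{0,1\}$, where $I$ is an interval of $\mathbb{Z}$ (a set of integers containing every integer lying between two of its elements). A factor of $\mu$ is a finite word $\mu(p)\mu(p+1)\cdots\mu(p+n-1)$ with $p, p+1,\dots,p+n-1\in I$; the word is then said to occur in $\mu$ at $p$. The sequence $\mu$ is recurrent if every finite factor of $\mu$ occurs at infinitely many positions. It is uniformly recurrent if for every $n\in\mathbb{N}$ there is $m\in\mathbb{N}$ such that each factor of $\mu$ of length $n$ occurs as a factor (a contiguous subword) of every factor of $\mu$ of length $m$. To $\mu$ associate the simple graph $G_\mu$ whose vertex set is $I$ if $I$ has no least element, and $\{a-1\}\cup I$ if $I$ has a least element $a$; for two vertices $i<j$, the pair $\{i,j\}$ is an edge of $G_\mu$ if and only if either $\mu(j)=1$ and $j=i+1$, or $\mu(j)=0$ and $j\neq i+1$. A graph embeds in another if it is isomorphic to an induced subgraph of it. The age of a graph $G$ is the class of finite graphs that embed in $G$. A class of finite graphs is hereditary if it contains every finite graph that embeds in one of its members. A module of a graph is a set $A$ of vertices such that every vertex outside $A$ is adjacent to all or to none of the vertices of $A$; a graph is prime if its only modules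 are the empty set, the singletons and the whole vertex set. A hereditary class of finite graphs is minimal prime if it contains infinitely many prime graphs, up to isomorphism, while every proper hereditary subclass contains only finitely many prime graphs, up to isomorphism. **Theorem.** Let $\mu$ be a $0$-$1$ sequence on an infinite interval of $\mathbb{Z}$. The following are equivalent: (i) $\mu$ is uniformly recurrent; (ii) $\mu$ is recurrent and the age of $G_\mu$ is minimal prime. -/

import Mathlib

/-! ### Words on an interval of the integers -/

/-- The finite word `w` occurs in the `0`-`1` sequence `μ` (defined on `I ⊆ ℤ`) at position `p`:
the integers `p, p + 1, …, p + |w| - 1` lie in `I` and `μ` takes there the letters of `w`. -/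
def OccursAt {I : Set ℤ} (μ : I → Fin 2) (w : List (Fin 2)) (p : ℤ) : Prop :=
  ∀ (k : ℕ) (hk : k < w.length), ∃ h : p + (k : ℤ) ∈ I, μ ⟨p + (k : ℤ), h⟩ = w[k]

/-- The finite word `w` is a factor of `μ`. -/
def IsFactor {I : Set ℤ} (μ : I → Fin 2) (w : List (Fin 2)) : Prop :=
  ∃ p : ℤ, OccursAt μ w p

/-- `μ` is recurrent: every finite factor of `μ` occurs infinitely often. -/
def IsRecurrent {I : Set ℤ} (μ : I → Fin 2) : Prop :=
  ∀ w : List (Fin 2), IsFactor μ w → {p : ℤ | OccursAt μ w p}.Infinite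

/-- `μ` is uniformly recurrent: for every `n` there is `m` such that each factor of length `n`
is a factor (a contiguous subword, `<:+:`) of every factor of length `m`. -/
def IsUniformlyRecurrent {I : Set ℤ} (μ : I → Fin 2) : Prop :=
  ∀ n : ℕ, ∃ m : ℕ, ∀ u v : List (Fin 2),
    IsFactor μ u → u.length = n → IsFactor μ v → v.length = m → u <:+: v

/-- The vertex set of `G_μ` for a sequence on the interval `I`: it is `I` if `I` has no least
element, and `{a - 1} ∪ I` if `a` is the least element of `I`. -/
def wordVertices (I : Set ℤ) : Set ℤ :=
  {v : ℤ | v ∈ I ∨ IsLeast I (v + 1)}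

/-- The graph `G_μ`: for vertices `i < j`, the pair `{i, j}` is an edge if and only if
`μ j = 1` and `j = i + 1`, or `μ j = 0` and `j ≠ i + 1`.
(The larger of two distinct vertices always lies in the interval `I`.) -/
def wordGraph {I : Set ℤ} (μ : I → Fin 2) : SimpleGraph (wordVertices I) :=
  SimpleGraph.fromRel fun i j =>
    (i : ℤ) < j ∧ ∃ h : (j : ℤ) ∈ I,
      (μ ⟨j, h⟩ = 1 ∧ (j : ℤ) = i + 1) ∨ (μ ⟨j, h⟩ = 0 ∧ (j : ℤ) ≠ i + 1)

/-! ### Classes of finite graphs -/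

/-- Finite graphs. Every finite graph is isomorphic to one on some `Fin n`, and all notions below
are invariant under isomorphism. -/
abbrev FinGraph : Type := Σ n : ℕ, SimpleGraph (Fin n)

/-- Isomorphism of finite graphs. -/
def finGraphIso : Setoid FinGraph where
  r G H := Nonempty (G.2 ≃g H.2)
  iseqv := ⟨fun _ => ⟨RelIso.refl _⟩, fun ⟨e⟩ => ⟨e.symm⟩, fun ⟨e⟩ ⟨f⟩ => ⟨e.trans f⟩⟩

/-- The age of a graph: the finite graphs that embed in it as induced subgraphs. -/
def graphAge {V : Type*} (G : SimpleGraph V) : Set FinGraph :=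
  {H : FinGraph | H.2.IsIndContained G}

/-- A class of finite graphs is hereditary if it contains every finite graph that embeds
(as an induced subgraph) in some member of the class. -/
def IsHereditary (C : Set FinGraph) : Prop :=
  ∀ G H : FinGraph, H ∈ C → G.2.IsIndContained H.2 → G ∈ C

/-- A module of a graph: vertices outside of `A` do not distinguish the elements of `A`. -/
def IsGraphModule {V : Type*} (G : SimpleGraph V) (A : Set V) : Prop :=
  ∀ a ∈ A, ∀ a' ∈ A, ∀ x ∉ A, (G.Adj x a ↔ G.Adj x a')

/-- A graph is prime if its only modules are the trivial ones: the empty set, the singletons and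
the whole vertex set. -/
def IsPrimeGraph {V : Type*} (G : SimpleGraph V) : Prop :=
  ∀ A : Set V, IsGraphModule G A → A = ∅ ∨ (∃ v : V, A = {v}) ∨ A = Set.univ

/-- The isomorphism types of the prime members of a class of finite graphs. -/
def primeTypes (C : Set FinGraph) : Set (Quotient finGraphIso) :=
  Quotient.mk finGraphIso '' {G : FinGraph | G ∈ C ∧ IsPrimeGraph G.2}

/-- A class of finite graphs is minimal prime if it is hereditary, contains infinitely many prime
graphs (up to isomorphism), and every proper hereditary subclass contains only finitely many. -/
def IsMinimalPrimeClass (C : Set FinGraph) : Prop :=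
  IsHereditary C ∧ (primeTypes C).Infinite ∧
    ∀ D : Set FinGraph, IsHereditary D → D ⊂ C → (primeTypes D).Finite

/-! A vertex `j` treats all smaller vertices alike, except that it separates `j - 1` from the
others. Everything rests on this asymmetry.

It makes modules of segments very restricted: a segment can fail to be prime only if its word is
constant up to the borders, and constant segments on at least four vertices are prime. Hence long
segments contain long prime ones (`exists_isPrimeGraph_segGraph`). Conversely, an embedded prime
graph must fill a run of consecutive integers, one fewer than its vertices
(`IsPrimeGraph.exists_segment_subset_range`). If `μ` is uniformly recurrent, such a run, once long
enough, contains any given factor; so a hereditary subclass of the age with infinitely many primes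
contains every finite segment, that is, the whole age.

For the converse, suppose that some factor `u` is missing from arbitrarily long blocks. The graphs
embedding in `u`-free segments form a hereditary class with infinitely many primes. It is a proper
subclass of the age by rigidity: after two occurrences of each letter, an embedding of a segment is
a letter-preserving translation (`translation_of_embedding`), so a segment with such a beginning
followed by `u` embeds in no `u`-free segment. Recurrence provides that beginning in front of `u`
unless `μ` is constant, and constant sequences are uniformly recurrent. -/

/-- The graph on `ℤ` in which `i < j` are adjacent if and only if `w j` holds and `j = i + 1`, or
`w j` fails and `j ≠ i + 1`. -/
def chainGraph (w : ℤ → Prop) : SimpleGraph ℤ where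
  Adj i j := (i < j ∧ (w j ↔ j = i + 1)) ∨ (j < i ∧ (w i ↔ i = j + 1))
  symm := ⟨fun _ _ h => h.symm⟩
  loopless := ⟨fun _ h => by rcases h with h | h <;> exact lt_irrefl _ h.1⟩

theorem chainGraph_adj_of_lt {w : ℤ → Prop} {i j : ℤ} (h : i < j) :
    (chainGraph w).Adj i j ↔ (w j ↔ j = i + 1) := by
  have : ¬ j < i := by omega
  simp [chainGraph, h, this]

theorem chainGraph_adj_of_gt {w : ℤ → Prop} {i j : ℤ} (h : j < i) :
    (chainGraph w).Adj i j ↔ (w i ↔ i = j + 1) := by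
  rw [SimpleGraph.adj_comm, chainGraph_adj_of_lt h]

/-- The subgraph of `chainGraph w` induced on the `n` integers from `a` on. -/
def segGraph (w : ℤ → Prop) (a : ℤ) (n : ℕ) : SimpleGraph (Fin n) :=
  (chainGraph w).comap fun i => a + (i : ℕ)

/-! ### Prime segments -/

/-- `M` is a module of the subgraph of `chainGraph w` induced on `[a, b]`. -/
structure IsSegModule (w : ℤ → Prop) (a b : ℤ) (M : Set ℤ) : Prop where
  subset : M ⊆ Set.Icc a b
  adj_iff : ∀ x ∈ M, ∀ y ∈ M, ∀ c, a ≤ c → c ≤ b → c ∉ M →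
    ((chainGraph w).Adj c x ↔ (chainGraph w).Adj c y)

/-- If `k` and a smaller `x` are in the module, then `k + 1` separates its predecessor `k` from `x`,
so it is absorbed too. -/
theorem IsSegModule.mem_of_lt_of_le {w : ℤ → Prop} {a b : ℤ} {M : Set ℤ}
    (hM : IsSegModule w a b M) {x y : ℤ} (hx : x ∈ M) (hy : y ∈ M) (hxy : x < y) {k : ℤ}
    (hyk : y ≤ k) (hk : k ≤ b) : k ∈ M := by
  induction k, hyk using Int.leInduction with
  | base => exact hy
  | succ k hyk ih =>
    have hkM := ih (by omega)
    by_contra hn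
    have hax := (hM.subset hx).1
    have h := hM.adj_iff x hx k hkM (k + 1) (by omega) hk hn
    rw [chainGraph_adj_of_gt (by omega), chainGraph_adj_of_gt (by omega)] at h
    have h' : k + 1 ≠ x + 1 := by omega
    simp [h'] at h

/-- A nontrivial module of a segment is a final interval `(g, b]`, up to one further vertex. -/
theorem IsSegModule.exists_gap {w : ℤ → Prop} {a b : ℤ} {M : Set ℤ}
    (hM : IsSegModule w a b M) {x y : ℤ} (hx : x ∈ M) (hy : y ∈ M) (hxy : x < y)
    (hne : ∃ c, a ≤ c ∧ c ≤ b ∧ c ∉ M) :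
    ∃ g, a ≤ g ∧ g < b ∧ g ∉ M ∧ (∀ k, g < k → k ≤ b → k ∈ M) ∧
      ∀ s ∈ M, ∀ t ∈ M, s < g → t < g → s = t := by
  obtain ⟨g, ⟨hag, hgb, hgM⟩, hmax⟩ := Int.exists_greatest_of_bdd
    (P := fun c => a ≤ c ∧ c ≤ b ∧ c ∉ M) ⟨b, fun z hz => hz.2.1⟩ hne
  have hb : b ∈ M := hM.mem_of_lt_of_le hx hy hxy (hM.subset hy).2 le_rfl
  refine ⟨g, hag, lt_of_le_of_ne hgb (by rintro rfl; exact hgM hb), hgM, ?_, ?_⟩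
  · intro k hgk hkb
    by_contra hk
    have := hmax k ⟨by omega, hkb, hk⟩
    omega
  · intro s hs t ht hsg htg
    rcases lt_trichotomy s t with h | h | h
    · exact absurd (hM.mem_of_lt_of_le hs ht h htg.le hgb) hgM
    · exact h
    · exact absurd (hM.mem_of_lt_of_le ht hs h hsg.le hgb) hgM

/-- The gap `g` is consecutive to `g + 1` but to no later vertex, so seeing them alike forces the
later letters to be opposite to that of `g + 1`. A vertex below `g` is consecutive to neither `g +
1` nor `g + 2`, so these opposite letters make it separate them. -/
theorem IsSegModule.const_of_gap {w : ℤ → Prop} {a b : ℤ} {M : Set ℤ}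
    (hM : IsSegModule w a b M) {g : ℤ} (hag : a ≤ g) (hgb : g + 2 ≤ b) (hg : g ∉ M)
    (hup : ∀ k, g < k → k ≤ b → k ∈ M) :
    (∀ k, g + 2 ≤ k → k ≤ b → (w k ↔ ¬ w (g + 1))) ∧ ∀ c, a ≤ c → c < g → c ∈ M := by
  have h1 : ∀ k, g + 2 ≤ k → k ≤ b → (w k ↔ ¬ w (g + 1)) := by
    intro k hk hkb
    have h := hM.adj_iff (g + 1) (hup _ (by omega) (by omega)) k (hup _ (by omega) hkb) g hag
      (by omega) hg
    rw [chainGraph_adj_of_lt (by omega), chainGraph_adj_of_lt (by omega)] at h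
    have h' : k ≠ g + 1 := by omega
    simp only [h', iff_true, iff_false] at h
    tauto
  refine ⟨h1, fun c hac hcg => ?_⟩
  by_contra hc
  have h := hM.adj_iff (g + 1) (hup _ (by omega) (by omega)) (g + 2) (hup _ (by omega) (by omega))
    c hac (by omega) hc
  rw [chainGraph_adj_of_lt (by omega), chainGraph_adj_of_lt (by omega)] at h
  have h' : g + 1 ≠ c + 1 := by omega
  have h'' : g + 2 ≠ c + 1 := by omega
  have := h1 (g + 2) le_rfl hgb
  simp only [h', h'', iff_false] at h
  tauto

/-- If a segment has a nontrivial module, then its word is constant up to the borders. -/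
theorem IsSegModule.const_of_nontrivial {w : ℤ → Prop} {a b : ℤ} {M : Set ℤ}
    (hM : IsSegModule w a b M) {x y : ℤ} (hx : x ∈ M) (hy : y ∈ M) (hxy : x < y)
    (hne : ∃ c, a ≤ c ∧ c ≤ b ∧ c ∉ M) {i j : ℤ} (hi : a + 3 ≤ i) (hib : i ≤ b - 2)
    (hj : a + 3 ≤ j) (hjb : j ≤ b - 2) : w i ↔ w j := by
  obtain ⟨g, hag, hgb, hg, hup, huniq⟩ := hM.exists_gap hx hy hxy hne
  rcases Int.lt_or_le (g + 1) b with hb | hb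
  · obtain ⟨h1, h2⟩ := hM.const_of_gap hag (by omega) hg hup
    have hga : g ≤ a + 1 := by
      by_contra hga
      have := huniq a (h2 a le_rfl (by omega)) (a + 1) (h2 (a + 1) (by omega) (by omega))
        (by omega) (by omega)
      omega
    rw [h1 i (by omega) (by omega), h1 j (by omega) (by omega)]
  -- Now `g = b - 1` and the module is the pair `{x, b}`. The other vertices below `b - 1` see `b`,
  -- hence `x`, in one uniform way; this forces `x` to the left border and then fixes the letters to
  -- its right.
  · have hbM := hup b hgb le_rfl
    have hxb := (hM.subset hy).2
    have hxa := (hM.subset hx).1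
    have hxg : x < g := by
      rcases lt_trichotomy x g with h | h | h
      · exact h
      · exact absurd (h ▸ hx) hg
      · omega
    have hout : ∀ c, a ≤ c → c < b → c ≠ x → c ∉ M := by
      intro c hac hcb hcx hc
      rcases eq_or_ne c g with rfl | hcg
      · exact hg hc
      · exact hcx (huniq c hc x hx (by omega) hxg)
    have hbig : ∀ c, a ≤ c → c < b - 1 → c ≠ x → ((chainGraph w).Adj c x ↔ ¬ w b) := by
      intro c hac hcb hcx
      rw [hM.adj_iff x hx b hbM c hac (by omega) (hout c hac (by omega) hcx),
        chainGraph_adj_of_lt (by omega)]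
      have : b ≠ c + 1 := by omega
      simp [this]
    have hxa : x ≤ a + 1 := by
      by_contra hlt
      have h1 := hbig a le_rfl (by omega) (by omega)
      have h2 := hbig (x - 1) (by omega) (by omega) (by omega)
      rw [chainGraph_adj_of_lt (by omega)] at h1 h2
      have h3 : x ≠ a + 1 := by omega
      simp only [h3, sub_add_cancel, iff_false, iff_true] at h1 h2
      tauto
    have hc : ∀ c, a + 3 ≤ c → c ≤ b - 2 → (w c ↔ w b) := by
      intro c hac hcb
      have h1 := hbig c (by omega) (by omega) (by omega)
      rw [chainGraph_adj_of_gt (by omega)] at h1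
      have h3 : c ≠ x + 1 := by omega
      simp only [h3, iff_false] at h1
      tauto
    rw [hc i hi hib, hc j hj hjb]

/-- With equal letters the only remaining candidate is a pair `{x, b}` with gap `b - 1`. The gap
sees both alike only if `x = b - 2`, but then `x - 1` separates `x` from `b`. -/
theorem IsSegModule.trivial_of_const {w : ℤ → Prop} {a b : ℤ} {M : Set ℤ}
    (hM : IsSegModule w a b M) {x y : ℤ} (hx : x ∈ M) (hy : y ∈ M) (hxy : x < y)
    (hab : a + 3 ≤ b) (hw : ∀ i j, a < i → i ≤ b → a < j → j ≤ b → (w i ↔ w j)) :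
    ∀ c, a ≤ c → c ≤ b → c ∈ M := by
  by_contra! hne
  obtain ⟨g, hag, hgb, hg, hup, huniq⟩ := hM.exists_gap hx hy hxy hne
  rcases Int.lt_or_le (g + 1) b with hb | hb
  · have h1 := (hM.const_of_gap hag (by omega) hg hup).1 (g + 2) le_rfl (by omega)
    have h2 := hw (g + 1) (g + 2) (by omega) (by omega) (by omega) (by omega)
    tauto
  · have hbM := hup b hgb le_rfl
    have hxb := (hM.subset hy).2
    have hxa := (hM.subset hx).1
    have hxg : x < g := by
      rcases lt_trichotomy x g with h | h | h
      · exact h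
      · exact absurd (h ▸ hx) hg
      · omega
    have h1 := hM.adj_iff x hx b hbM g hag hgb.le hg
    rw [chainGraph_adj_of_gt hxg, chainGraph_adj_of_lt hgb] at h1
    have h2 := hw g b (by omega) (by omega) (by omega) (by omega)
    have h3 : b = g + 1 := by omega
    have h4 : g = x + 1 := by
      by_contra h4
      simp only [← h3, h4, iff_false, iff_true] at h1
      tauto
    have h5 : x - 1 ∉ M := fun h => by
      have := huniq _ h x hx (by omega) hxg
      omega
    have h6 := hM.adj_iff x hx b hbM (x - 1) (by omega) (by omega) h5
    rw [chainGraph_adj_of_lt (by omega), chainGraph_adj_of_lt (by omega)] at h6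
    have h7 := hw x b (by omega) (by omega) (by omega) (by omega)
    have h8 : b ≠ x := by omega
    simp only [h8, sub_add_cancel, iff_false, iff_true] at h6
    tauto

/-- A segment is prime if the modules in the sense of `IsSegModule` are trivial. -/
theorem isPrimeGraph_segGraph {w : ℤ → Prop} {a : ℤ} {n : ℕ}
    (h : ∀ M, IsSegModule w a (a + n - 1) M → ∀ x ∈ M, ∀ y ∈ M, x < y →
      ∀ c, a ≤ c → c ≤ a + n - 1 → c ∈ M) : IsPrimeGraph (segGraph w a n) := by
  intro A hA
  set M : Set ℤ := (fun i : Fin n => a + ((i : ℕ) : ℤ)) '' A with hMdef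
  have hmem : ∀ i : Fin n, a + ((i : ℕ) : ℤ) ∈ M ↔ i ∈ A := by
    intro i
    refine ⟨?_, fun hi => ⟨i, hi, rfl⟩⟩
    rintro ⟨k, hk, hki⟩
    have : k = i := Fin.ext (by simpa using hki)
    exact this ▸ hk
  have hM : IsSegModule w a (a + n - 1) M := by
    constructor
    · rintro _ ⟨i, -, rfl⟩
      have := i.2
      simp only [Set.mem_Icc]
      omega
    · rintro _ ⟨i, hi, rfl⟩ _ ⟨j, hj, rfl⟩ c hac hcb hc
      lift c - a to ℕ using (by omega) with d hd
      obtain rfl : c = a + d := by omega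
      exact hA i hi j hj ⟨d, by omega⟩ fun hd' => hc ((hmem _).2 hd')
  by_cases hs : A.Subsingleton
  · rcases hs.eq_empty_or_singleton with h0 | h1
    · exact Or.inl h0
    · exact Or.inr (Or.inl h1)
  · obtain ⟨i, hi, j, hj, hij⟩ := Set.not_subsingleton_iff.1 hs |>.exists_lt
    refine Or.inr (Or.inr (Set.eq_univ_of_forall fun k => (hmem k).1 ?_))
    have hk := k.2
    exact h M hM _ ((hmem i).2 hi) _ ((hmem j).2 hj) (by simpa using hij) _ (by omega) (by omega)

/-- Every long segment contains a long prime segment. -/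
theorem exists_isPrimeGraph_segGraph (w : ℤ → Prop) (c : ℤ) (N : ℕ) :
    ∃ (a : ℤ) (n : ℕ), N ≤ n ∧ c ≤ a ∧ a + n ≤ c + N + 8 ∧ IsPrimeGraph (segGraph w a n) := by
  by_cases hp : IsPrimeGraph (segGraph w c (N + 8))
  · exact ⟨c, N + 8, by omega, le_rfl, by push_cast; omega, hp⟩
  · have := mt isPrimeGraph_segGraph hp
    push Not at this
    obtain ⟨M, hM, x, hx, y, hy, hxy, hne⟩ := this
    push_cast at hM hne
    -- The letter of the least vertex plays no role, so this segment may start one step before the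
    -- constant stretch `[c + 3, c + N + 5]`.
    refine ⟨c + 2, N + 4, by omega, by omega, by push_cast; omega,
      isPrimeGraph_segGraph fun M' hM' x' hx' y' hy' hxy' => ?_⟩
    push_cast at hM' ⊢
    exact hM'.trivial_of_const hx' hy' hxy' (by omega) fun i j hi hib hj hjb =>
      hM.const_of_nontrivial hx hy hxy hne (by omega) (by omega) (by omega) (by omega)

/-- The image of an embedding of a prime graph with `k` vertices into `chainGraph w` contains
`k - 1` consecutive integers. -/
theorem IsPrimeGraph.exists_segment_subset_range {w : ℤ → Prop} {k : ℕ}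
    {G : SimpleGraph (Fin k)} (hG : IsPrimeGraph G) (hk : 0 < k) (g : G ↪g chainGraph w) :
    ∃ c : ℤ, ∀ i, c ≤ i → i < c + k - 1 → i ∈ Set.range g := by
  have : Nonempty (Fin k) := ⟨⟨0, hk⟩⟩
  obtain ⟨m, hm⟩ := Finite.exists_max g
  refine ⟨g m - k + 2, fun t ht1 ht2 => ?_⟩
  by_contra ht
  have hne : ∀ x, g x ≠ t := fun x hx => ht ⟨x, hx⟩
  -- No vertex with image above the missing `t` is consecutive to an image below `t`. The vertices
  -- below `t` are thus a module, proper because of `m`, and with at least two elements because at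
  -- most `k - 2` images fit above `t`.
  have hmod : IsGraphModule G {x | g x < t} := by
    intro x hx y hy c hc
    have hc' := hne c
    simp only [Set.mem_ofPred_eq] at hx hy hc
    rw [← g.map_adj_iff, ← g.map_adj_iff, chainGraph_adj_of_gt (by omega),
      chainGraph_adj_of_gt (by omega)]
    have h1 : g c ≠ g x + 1 := by omega
    have h2 : g c ≠ g y + 1 := by omega
    simp [h1, h2]
  have hmt : t < g m := by
    have := hne m
    omega
  have hcard : {x | g x < t}ᶜ.ncard ≤ k - 2 := by
    have hsub : g '' {x | g x < t}ᶜ ⊆ Set.Ioc t (g m) := by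
      rintro _ ⟨x, hx, rfl⟩
      have := hne x
      simp only [Set.mem_compl_iff, Set.mem_ofPred_eq] at hx
      exact ⟨by omega, hm x⟩
    rw [← Set.ncard_image_of_injective _ g.injective]
    refine (Set.ncard_le_ncard hsub (Set.finite_Ioc _ _)).trans ?_
    rw [← Finset.coe_Ioc, Set.ncard_coe_finset, Int.card_Ioc]
    omega
  have hcard' := Set.ncard_add_ncard_compl {x | g x < t}
  rw [Nat.card_eq_fintype_card, Fintype.card_fin] at hcard'
  rcases hG _ hmod with h | ⟨v, h⟩ | h
  · rw [h, Set.ncard_empty] at hcard'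
    rw [h] at hcard
    omega
  · have h1 : {x | g x < t}.ncard = 1 := by rw [h, Set.ncard_singleton]
    omega
  · have : m ∈ {x | g x < t} := h ▸ Set.mem_univ m
    simp only [Set.mem_ofPred_eq] at this
    omega

/-! ### Rigidity of embeddings -/

theorem eq_sub_one_of_not_adj_iff {w : ℤ → Prop} {j x y : ℤ} (hx : x < j) (hy : y < j)
    (h : ¬ ((chainGraph w).Adj j x ↔ (chainGraph w).Adj j y)) : x = j - 1 ∨ y = j - 1 := by
  by_contra! hn
  rw [chainGraph_adj_of_gt hx, chainGraph_adj_of_gt hy] at h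
  have h1 : j ≠ x + 1 := by omega
  have h2 : j ≠ y + 1 := by omega
  simp [h1, h2] at h

/-- If an embedding of chain graphs defined on `X` takes its maximum at `j`, then it takes the
second largest value at `j - 1`, and `j` is adjacent to all or to none of the other vertices. -/
theorem apply_sub_one_of_max {w w' : ℤ → Prop} {X : Set ℤ} {f : ℤ → ℤ}
    (hinj : Set.InjOn f X)
    (hf : ∀ x ∈ X, ∀ y ∈ X, ((chainGraph w').Adj (f x) (f y) ↔ (chainGraph w).Adj x y))
    {a j : ℤ} (haj : a + 3 ≤ j) (ha : a ∈ X) (ha1 : a + 1 ∈ X) (hj1 : j - 1 ∈ X) (hj : j ∈ X)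
    (hmax : ∀ x ∈ X, f x ≤ f j) :
    f (j - 1) = f j - 1 ∧ (∀ x ∈ X, x ≠ j → f x ≤ f (j - 1)) ∧
      (∀ x ∈ X, x ≠ j → x ≠ j - 1 → ((chainGraph w).Adj j x ↔ ¬ w j)) ∧ (w' (f j) ↔ w j) := by
  have hlt : ∀ x ∈ X, x ≠ j → f x < f j := fun x hx hxj =>
    lt_of_le_of_ne (hmax x hx) fun h => hxj (hinj hx hj h)
  have hdist : ∀ x ∈ X, x < j - 1 → ¬ ((chainGraph w').Adj (f j) (f (j - 1)) ↔
      (chainGraph w').Adj (f j) (f x)) := by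
    intro x hx hxj
    rw [hf j hj _ hj1, hf j hj x hx, chainGraph_adj_of_gt (by omega),
      chainGraph_adj_of_gt (by omega)]
    have h1 : j ≠ x + 1 := by omega
    simp only [h1, sub_add_cancel, iff_true, iff_false]
    tauto
  -- Two witnesses `a` and `a + 1` are separated from `j - 1` by `j`; injectivity lets at most one
  -- of them map to `f j - 1`, so `j - 1` does.
  have h1 : f (j - 1) = f j - 1 := by
    rcases eq_sub_one_of_not_adj_iff (hlt _ hj1 (by omega)) (hlt _ ha (by omega))
      (hdist a ha (by omega)) with h | h
    · exact h
    rcases eq_sub_one_of_not_adj_iff (hlt _ hj1 (by omega)) (hlt _ ha1 (by omega))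
      (hdist (a + 1) ha1 (by omega)) with h' | h'
    · exact h'
    have := hinj ha ha1 (h.trans h'.symm)
    omega
  have h2 : ∀ x ∈ X, x ≠ j → x ≠ j - 1 → f x < f j - 1 := by
    intro x hx hxj hxj1
    have h3 := hlt x hx hxj
    have h4 : f x ≠ f (j - 1) := fun h => hxj1 (hinj hx hj1 h)
    omega
  have h3 : ∀ x ∈ X, x ≠ j → x ≠ j - 1 → ((chainGraph w).Adj j x ↔ ¬ w' (f j)) := by
    intro x hx hxj hxj1
    have h4 := h2 x hx hxj hxj1
    have h5 : f j ≠ f x + 1 := by omega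
    rw [← hf j hj x hx, chainGraph_adj_of_gt (by omega)]
    simp [h5]
  have h4 : w' (f j) ↔ w j := by
    have h5 := h3 a ha (by omega) (by omega)
    rw [chainGraph_adj_of_gt (by omega)] at h5
    have h6 : j ≠ a + 1 := by omega
    simp only [h6, iff_false] at h5
    tauto
  refine ⟨h1, fun x hx hxj => ?_, fun x hx hxj hxj1 => by
    rw [h3 x hx hxj hxj1, h4], h4⟩
  rcases eq_or_ne x (j - 1) with rfl | hxj1
  · exact le_rfl
  · have := h2 x hx hxj hxj1
    omega

/-- If the word on `[a + 6, b - 2]` contains both letters at least twice, then an embedding of the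
segment `[a, b]` into a chain graph takes its maximum at `b`. -/
theorem max_of_embedding {w w' : ℤ → Prop} {a b : ℤ} {f : ℤ → ℤ}
    (hinj : Set.InjOn f (Set.Icc a b))
    (hf : ∀ x ∈ Set.Icc a b, ∀ y ∈ Set.Icc a b,
      ((chainGraph w').Adj (f x) (f y) ↔ (chainGraph w).Adj x y))
    {s t s' t' : ℤ} (hst : s < t) (hs : a + 6 ≤ s) (ht : t ≤ b - 2) (hws : w s) (hwt : w t)
    (hst' : s' < t') (hs' : a + 6 ≤ s') (ht' : t' ≤ b - 2) (hws' : ¬ w s') (hwt' : ¬ w t') :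
    ∀ x ∈ Set.Icc a b, f x ≤ f b := by
  obtain ⟨j, hj, hmax⟩ := Set.exists_max_image (Set.Icc a b) f (Set.finite_Icc a b)
    ⟨a, by simp only [Set.mem_Icc]; omega⟩
  rcases eq_or_ne j b with rfl | hjb
  · exact hmax
  exfalso
  obtain ⟨haj, hjb'⟩ := hj
  have hjb : j < b := lt_of_le_of_ne hjb' hjb
  rcases Int.lt_or_le j (a + 4) with hj4 | hj4
  -- If the maximum is far left, `j` separates later vertices by their letters, so every pair of
  -- opposite letters must use the single value `f j - 1`. Two positions of each letter give four
  -- pairs, which no single position can meet.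
  · have key : ∀ x y, j + 2 ≤ x → x ≤ b → j + 2 ≤ y → y ≤ b → w x → ¬ w y →
        f x = f j - 1 ∨ f y = f j - 1 := by
      intro x y hx hxb hy hyb hwx hwy
      have hlt : ∀ z, j + 2 ≤ z → z ≤ b → f z < f j := fun z hz hzb =>
        lt_of_le_of_ne (hmax z ⟨by omega, hzb⟩) fun h => by
          have := hinj ⟨by omega, hzb⟩ ⟨haj, hjb'⟩ h
          omega
      refine eq_sub_one_of_not_adj_iff (w := w') (hlt x hx hxb) (hlt y hy hyb) ?_
      rw [hf j ⟨haj, hjb'⟩ x ⟨by omega, hxb⟩, hf j ⟨haj, hjb'⟩ y ⟨by omega, hyb⟩,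
        chainGraph_adj_of_lt (by omega), chainGraph_adj_of_lt (by omega)]
      have h1 : x ≠ j + 1 := by omega
      have h2 : y ≠ j + 1 := by omega
      simp [h1, h2, hwx, hwy]
    have hne : ∀ x y, a ≤ x → x < y → y ≤ b → f x = f j - 1 → f y = f j - 1 → False := by
      intro x y hx hxy hy h1 h2
      have := hinj ⟨hx, by omega⟩ ⟨by omega, hy⟩ (h1.trans h2.symm)
      omega
    have k1 := key s s' (by omega) (by omega) (by omega) (by omega) hws hws'
    have k2 := key s t' (by omega) (by omega) (by omega) (by omega) hws hwt'
    have k3 := key t s' (by omega) (by omega) (by omega) (by omega) hwt hws'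
    have k4 := key t t' (by omega) (by omega) (by omega) (by omega) hwt hwt'
    have n1 := hne s t (by omega) hst (by omega)
    have n2 := hne s' t' (by omega) hst' (by omega)
    tauto
  -- Otherwise the vertices are peeled off downwards from `j`: on what is left, together with the
  -- vertices beyond `j`, the maximum is at `i`, then at `i - 1`. So each `i` sees all vertices
  -- beyond `j` in the way prescribed by its own letter.
  · have step : ∀ i, a + 3 ≤ i → i ≤ j → (∀ x ∈ Set.Icc a b, (x ≤ i ∨ j < x) → f x ≤ f i) →
        (∀ x ∈ Set.Icc a b, (x ≤ i - 1 ∨ j < x) → f x ≤ f (i - 1)) ∧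
          ∀ x, j < x → x ≤ b → ((chainGraph w).Adj i x ↔ ¬ w i) := by
      intro i hi hij hm
      obtain ⟨-, h1, h2, -⟩ := apply_sub_one_of_max (w := w) (w' := w')
        (X := {x | x ∈ Set.Icc a b ∧ (x ≤ i ∨ j < x)}) (f := f) (a := a) (j := i)
        (hinj.mono fun x hx => hx.1) (fun x hx y hy => hf x hx.1 y hy.1) hi
        (by simp only [Set.mem_ofPred_eq, Set.mem_Icc]; omega)
        (by simp only [Set.mem_ofPred_eq, Set.mem_Icc]; omega)
        (by simp only [Set.mem_ofPred_eq, Set.mem_Icc]; omega)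
        (by simp only [Set.mem_ofPred_eq, Set.mem_Icc]; omega) (fun x hx => hm x hx.1 hx.2)
      exact ⟨fun x hx hxi => h1 x ⟨hx, by omega⟩ (by omega), fun x hjx hxb =>
        h2 x ⟨⟨by omega, hxb⟩, Or.inr hjx⟩ (by omega) (by omega)⟩
    have hall : ∀ d : ℕ, a + 3 ≤ j - d →
        ∀ x ∈ Set.Icc a b, (x ≤ j - d ∨ j < x) → f x ≤ f (j - d) := by
      intro d
      induction d with
      | zero => intro _ x hx _; simpa using hmax x hx
      | succ d ih =>
        intro hd x hx hxd
        push_cast at hd hxd ⊢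
        have := (step (j - d) (by omega) (by omega) (ih (by omega))).1 x hx (by omega)
        rwa [sub_sub] at this
    have hadj : ∀ i, a + 3 ≤ i → i ≤ j → ∀ x, j < x → x ≤ b →
        ((chainGraph w).Adj i x ↔ ¬ w i) := by
      intro i hi hij
      have hd := hall (j - i).toNat (by omega)
      rw [Int.toNat_of_nonneg (by omega), sub_sub_cancel] at hd
      exact (step i hi hij hd).2
    have h1 := hadj j (by omega) le_rfl (j + 1) (by omega) (by omega)
    rw [chainGraph_adj_of_lt (by omega)] at h1
    simp only [iff_true] at h1
    have h2 : ∀ i, a + 3 ≤ i → i < j → ∀ x, j < x → x ≤ b → (w x ↔ w i) := by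
      intro i hi hij x hjx hxb
      have h := hadj i hi hij.le x hjx hxb
      rw [chainGraph_adj_of_lt (by omega)] at h
      have h3 : x ≠ i + 1 := by omega
      simp only [h3, iff_false] at h
      tauto
    have h3 : ∀ x, j + 1 < x → x ≤ b → (w x ↔ w j) := by
      intro x hjx hxb
      have h := hadj j (by omega) le_rfl x (by omega) hxb
      rw [chainGraph_adj_of_lt (by omega)] at h
      have h3 : x ≠ j + 1 := by omega
      simp only [h3, iff_false] at h
      tauto
    have h4 : b = j + 1 := by
      by_contra hb
      have h5 := h2 (j - 1) (by omega) (by omega) (j + 1) (by omega) (by omega)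
      have h6 := h2 (j - 1) (by omega) (by omega) (j + 2) (by omega) (by omega)
      have h7 := h3 (j + 2) (by omega) (by omega)
      tauto
    have h5 := h2 s (by omega) (by omega) b (by omega) le_rfl
    have h6 := h2 s' (by omega) (by omega) b (by omega) le_rfl
    tauto

/-- An embedding of a segment of a chain graph is a translation on its final part, and it preserves
the letters there. -/
theorem translation_of_embedding {w w' : ℤ → Prop} {a b : ℤ} {f : ℤ → ℤ}
    (hinj : Set.InjOn f (Set.Icc a b))
    (hf : ∀ x ∈ Set.Icc a b, ∀ y ∈ Set.Icc a b,
      ((chainGraph w').Adj (f x) (f y) ↔ (chainGraph w).Adj x y))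
    {c s t s' t' : ℤ} (hst : s < t) (hs : a + 6 ≤ s) (ht : t ≤ c - 2) (hws : w s) (hwt : w t)
    (hst' : s' < t') (hs' : a + 6 ≤ s') (ht' : t' ≤ c - 2) (hws' : ¬ w s') (hwt' : ¬ w t')
    {i : ℤ} (hci : c ≤ i) (hib : i ≤ b) :
    f (i - 1) = f i - 1 ∧ (w' (f i) ↔ w i) := by
  have hsub : Set.Icc a i ⊆ Set.Icc a b := Set.Icc_subset_Icc le_rfl hib
  have hm := max_of_embedding (hinj.mono hsub) (fun x hx y hy => hf x (hsub hx) y (hsub hy))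
    hst hs (by omega) hws hwt hst' hs' (by omega) hws' hwt'
  obtain ⟨h1, -, -, h2⟩ := apply_sub_one_of_max (a := a) (hinj.mono hsub)
    (fun x hx y hy => hf x (hsub hx) y (hsub hy)) (by omega)
    (by simp only [Set.mem_Icc]; omega) (by simp only [Set.mem_Icc]; omega)
    (by simp only [Set.mem_Icc]; omega) (by simp only [Set.mem_Icc]; omega) hm
  exact ⟨h1, h2⟩

/-! ### Words and occurrences -/

section Words

variable {I : Set ℤ} {μ : I → Fin 2}

/-- The predicate on `ℤ` that holds at the positions in `I` with letter `1`. -/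
def wordPred (μ : I → Fin 2) (k : ℤ) : Prop :=
  ∃ h : k ∈ I, μ ⟨k, h⟩ = 1

theorem wordPred_iff {k : ℤ} (h : k ∈ I) : wordPred μ k ↔ μ ⟨k, h⟩ = 1 :=
  ⟨fun ⟨_, h'⟩ => h', fun h' => ⟨h, h'⟩⟩

theorem Fin.two_eq_iff {x y : Fin 2} : x = y ↔ (x = 1 ↔ y = 1) := by
  omega

theorem OccursAt.mem {u : List (Fin 2)} {p k : ℤ} (h : OccursAt μ u p) (hpk : p ≤ k)
    (hk : k < p + u.length) : k ∈ I := by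
  obtain ⟨h', -⟩ := h (k - p).toNat (by omega)
  rwa [Int.toNat_of_nonneg (by omega), add_sub_cancel] at h'

theorem OccursAt.translate {u : List (Fin 2)} {p q : ℤ} (h : OccursAt μ u p)
    (hq : ∀ k, q ≤ k → k < q + u.length → k ∈ I)
    (hpq : ∀ k : ℕ, k < u.length → (wordPred μ (q + k) ↔ wordPred μ (p + k))) :
    OccursAt μ u q := by
  intro k hk
  obtain ⟨h1, h2⟩ := h k hk
  refine ⟨hq _ (by omega) (by omega), ?_⟩
  rw [← h2, Fin.two_eq_iff, ← wordPred_iff, ← wordPred_iff, hpq k hk]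

theorem OccursAt.wordPred_iff {u : List (Fin 2)} {p q : ℤ} (hp : OccursAt μ u p)
    (hq : OccursAt μ u q) {k : ℕ} (hk : k < u.length) :
    wordPred μ (q + k) ↔ wordPred μ (p + k) := by
  obtain ⟨h1, h2⟩ := hp k hk
  obtain ⟨h3, h4⟩ := hq k hk
  rw [_root_.wordPred_iff h1, _root_.wordPred_iff h3, h2, h4]

theorem exists_occursAt {p : ℤ} {n : ℕ} (h : ∀ k, p ≤ k → k < p + n → k ∈ I) :
    ∃ u : List (Fin 2), u.length = n ∧ OccursAt μ u p := by
  refine ⟨List.ofFn fun i : Fin n => μ ⟨p + (i : ℕ), h _ (by omega) (by omega)⟩, by simp, ?_⟩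
  intro k hk
  simp only [List.length_ofFn] at hk
  exact ⟨h _ (by omega) (by omega), by simp⟩

theorem OccursAt.isInfix {u v : List (Fin 2)} {p q : ℤ} (hu : OccursAt μ u p)
    (hv : OccursAt μ v q) (hqp : q ≤ p) (hle : p + u.length ≤ q + v.length) : u <:+: v := by
  have : u = (v.drop (p - q).toNat).take u.length := by
    refine List.ext_getElem (by simp; omega) fun k hk hk' => ?_
    obtain ⟨h1, h2⟩ := hu k hk
    obtain ⟨h3, h4⟩ := hv ((p - q).toNat + k) (by omega)
    rw [List.getElem_take, List.getElem_drop, ← h2, ← h4]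
    congr 2
    omega
  rw [this]
  exact (List.take_prefix _ _).isInfix.trans (List.drop_suffix _ _).isInfix

theorem OccursAt.exists_of_isInfix {u v : List (Fin 2)} {q : ℤ} (hv : OccursAt μ v q)
    (h : u <:+: v) : ∃ p, q ≤ p ∧ p + u.length ≤ q + v.length ∧ OccursAt μ u p := by
  obtain ⟨s, t, rfl⟩ := h
  refine ⟨q + s.length, by omega, by simp; omega, fun k hk => ?_⟩
  obtain ⟨h1, h2⟩ := hv (s.length + k) (by simp; omega)
  have h3 : q + ((s.length + k : ℕ) : ℤ) = q + s.length + k := by push_cast; ring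
  simp only [h3] at h1 h2
  refine ⟨h1, h2.trans ?_⟩
  rw [List.getElem_append_left (by simp; omega), List.getElem_append_right (by omega)]
  simp

/-- A sequence is uniformly recurrent if and only if every factor occurs with bounded gaps. -/
theorem isUniformlyRecurrent_iff : IsUniformlyRecurrent μ ↔
    ∀ u, IsFactor μ u → ∃ m : ℕ, ∀ q : ℤ, (∀ k, q ≤ k → k < q + m → k ∈ I) →
      ∃ p, q ≤ p ∧ p + u.length ≤ q + m ∧ OccursAt μ u p := by
  constructor
  · intro h u hu
    obtain ⟨m, hm⟩ := h u.length
    refine ⟨m, fun q hq => ?_⟩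
    obtain ⟨v, hv, hvq⟩ := exists_occursAt (μ := μ) hq
    have := hvq.exists_of_isInfix (hm u v hu rfl ⟨q, hvq⟩ hv)
    rwa [hv] at this
  · intro h n
    have h' : ∀ u, ∃ m : ℕ, IsFactor μ u → ∀ q : ℤ, (∀ k, q ≤ k → k < q + m → k ∈ I) →
        ∃ p, q ≤ p ∧ p + u.length ≤ q + m ∧ OccursAt μ u p := by
      intro u
      by_cases hu : IsFactor μ u
      · obtain ⟨m, hm⟩ := h u hu
        exact ⟨m, fun _ => hm⟩
      · exact ⟨0, fun h => absurd h hu⟩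
    choose m hm using h'
    -- There are finitely many words of length `n`, so one bound serves them all.
    obtain ⟨B, hB⟩ := ((List.finite_length_eq (Fin 2) n).image m).bddAbove
    refine ⟨B, fun u v hu hun ⟨q, hvq⟩ hv => ?_⟩
    have hmB : m u ≤ B := hB ⟨u, hun, rfl⟩
    obtain ⟨p, hqp, hp, hup⟩ := hm u hu q fun k hk hk' => hvq.mem hk (by omega)
    exact hup.isInfix hvq hqp (by omega)

theorem Set.OrdConnected.mem_of_le_of_le (hI : I.OrdConnected) {x y k : ℤ} (hx : x ∈ I)
    (hy : y ∈ I) (hxk : x ≤ k) (hky : k ≤ y) : k ∈ I :=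
  hI.out hx hy ⟨hxk, hky⟩

/-- An infinite interval contains arbitrarily long blocks beyond every bound, on one side. -/
theorem Set.OrdConnected.exists_block (hI : I.OrdConnected) (hinf : I.Infinite) :
    (∀ (B : ℤ) (n : ℕ), ∃ q, B < q ∧ ∀ k, q ≤ k → k < q + n → k ∈ I) ∨
      ∀ (B : ℤ) (n : ℕ), ∃ q, q + n < B ∧ ∀ k, q ≤ k → k < q + n → k ∈ I := by
  obtain ⟨x, hx⟩ := hinf.nonempty
  by_cases hA : BddAbove I
  · have hB : ¬ BddBelow I := fun hB => hinf (hB.finite_of_bddAbove hA)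
    rw [not_bddBelow_iff] at hB
    right
    intro B n
    obtain ⟨y, hy, hyB⟩ := hB (min B x - n - 1)
    exact ⟨y, by omega, fun k hk hk' => hI.mem_of_le_of_le hy hx hk (by omega)⟩
  · rw [not_bddAbove_iff] at hA
    left
    intro B n
    obtain ⟨y, hy, hyB⟩ := hA (max B x + n + 1)
    exact ⟨max B x + 1, by omega, fun k hk hk' => hI.mem_of_le_of_le hx hy (by omega) (by omega)⟩

theorem IsUniformlyRecurrent.isRecurrent (hI : I.OrdConnected) (hinf : I.Infinite)
    (h : IsUniformlyRecurrent μ) : IsRecurrent μ := by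
  intro u hu
  obtain ⟨m, hm⟩ := isUniformlyRecurrent_iff.1 h u hu
  rcases hI.exists_block hinf with hb | hb
  · refine Set.infinite_of_not_bddAbove (not_bddAbove_iff.2 fun B => ?_)
    obtain ⟨q, hq, hqI⟩ := hb B m
    obtain ⟨p, hqp, -, hp⟩ := hm q hqI
    exact ⟨p, hp, by omega⟩
  · refine Set.infinite_of_not_bddBelow (not_bddBelow_iff.2 fun B => ?_)
    obtain ⟨q, hq, hqI⟩ := hb B m
    obtain ⟨p, hqp, hpm, hp⟩ := hm q hqI
    exact ⟨p, hp, by omega⟩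

theorem occursAt_singleton_iff {c : Fin 2} {p : ℤ} :
    OccursAt μ [c] p ↔ ∃ h : p ∈ I, μ ⟨p, h⟩ = c := by
  constructor
  · intro h
    obtain ⟨h1, h2⟩ := h 0 (by simp)
    simp only [Nat.cast_zero, add_zero] at h1 h2
    exact ⟨h1, h2⟩
  · rintro ⟨h1, h2⟩ k hk
    obtain rfl : k = 0 := by simpa using hk
    simpa using ⟨h1, h2⟩

/-- A letter that occurs in a recurrent sequence occurs twice. -/
theorem IsRecurrent.exists_lt (h : IsRecurrent μ) {p : ℤ} (hp : p ∈ I) :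
    ∃ s t : ℤ, s < t ∧ s ∈ I ∧ t ∈ I ∧ (wordPred μ s ↔ wordPred μ p) ∧
      (wordPred μ t ↔ wordPred μ p) := by
  have hinf := h [μ ⟨p, hp⟩] ⟨p, occursAt_singleton_iff.2 ⟨hp, rfl⟩⟩
  obtain ⟨s, hs, t, ht, hst⟩ := hinf.nontrivial.exists_lt
  obtain ⟨hs, hs'⟩ := occursAt_singleton_iff.1 hs
  obtain ⟨ht, ht'⟩ := occursAt_singleton_iff.1 ht
  refine ⟨s, t, hst, hs, ht, ?_, ?_⟩
  · rw [wordPred_iff hs, wordPred_iff hp, hs']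
  · rw [wordPred_iff ht, wordPred_iff hp, ht']

theorem isUniformlyRecurrent_of_const
    (h : ∀ p ∈ I, ∀ q ∈ I, (wordPred μ p ↔ wordPred μ q)) : IsUniformlyRecurrent μ := by
  refine isUniformlyRecurrent_iff.2 fun u ⟨p, hp⟩ => ⟨u.length, fun q hq =>
    ⟨q, le_rfl, le_rfl, hp.translate hq fun k hk => h _ (hq _ (by omega) (by omega)) _
      (hp.mem (by omega) (by omega))⟩⟩

/-- Occurrences may accumulate in one direction only; three spaced ones can still be listed from
left to right. -/
theorem Set.Infinite.exists_far_apart {S : Set ℤ} (hS : S.Infinite) (g : ℤ) :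
    ∃ x ∈ S, ∃ y ∈ S, ∃ z ∈ S, x + g < y ∧ y + g < z := by
  obtain ⟨x, hx⟩ := hS.nonempty
  by_cases hA : BddAbove S
  · have hB : ¬ BddBelow S := fun hB => hS (hB.finite_of_bddAbove hA)
    rw [not_bddBelow_iff] at hB
    obtain ⟨y, hy, hyx⟩ := hB (x - g)
    obtain ⟨z, hz, hzy⟩ := hB (y - g)
    exact ⟨z, hz, y, hy, x, hx, by omega, by omega⟩
  · rw [not_bddAbove_iff] at hA
    obtain ⟨y, hy, hyx⟩ := hA (x + g)
    obtain ⟨z, hz, hzy⟩ := hA (y + g)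
    exact ⟨x, hx, y, hy, z, hz, by omega, by omega⟩

/-- In a recurrent sequence that is not constant, every factor has an occurrence that is preceded
by two occurrences of each letter, with `6` further positions in front of them. -/
theorem IsRecurrent.exists_preceded (hI : I.OrdConnected) (h : IsRecurrent μ) {p₁ p₂ : ℤ}
    (hp₁ : p₁ ∈ I) (hp₂ : p₂ ∈ I) (h₁ : wordPred μ p₁) (h₂ : ¬ wordPred μ p₂)
    {u : List (Fin 2)} (hu : IsFactor μ u) (hu0 : 0 < u.length) :
    ∃ a s t s' t' q : ℤ, a ∈ I ∧ a + 6 ≤ s ∧ s < t ∧ t + 2 ≤ q ∧ wordPred μ s ∧ wordPred μ t ∧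
      a + 6 ≤ s' ∧ s' < t' ∧ t' + 2 ≤ q ∧ ¬ wordPred μ s' ∧ ¬ wordPred μ t' ∧
        OccursAt μ u q := by
  obtain ⟨s, t, hst, hs, ht, hws, hwt⟩ := h.exists_lt hp₁
  obtain ⟨s', t', hst', hs', ht', hws', hwt'⟩ := h.exists_lt hp₂
  obtain ⟨r, hr⟩ := hu
  have hws : wordPred μ s := hws.2 h₁
  have hwt : wordPred μ t := hwt.2 h₁
  have hws' : ¬ wordPred μ s' := fun h => h₂ (hws'.1 h)
  have hwt' : ¬ wordPred μ t' := fun h => h₂ (hwt'.1 h)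
  have hr0 : r ∈ I := hr.mem le_rfl (by omega)
  have hr1 : r + u.length - 1 ∈ I := hr.mem (by omega) (by omega)
  obtain ⟨c, hc, hcs, hcs', hcr⟩ : ∃ c ∈ I, c ≤ s ∧ c ≤ s' ∧ c ≤ r := by
    rcases le_total s s' with h1 | h1
    · rcases le_total s r with h2 | h2
      · exact ⟨s, hs, le_rfl, h1, h2⟩
      · exact ⟨r, hr0, h2, by omega, le_rfl⟩
    · rcases le_total s' r with h2 | h2
      · exact ⟨s', hs', h1, le_rfl, h2⟩
      · exact ⟨r, hr0, by omega, h2, le_rfl⟩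
  obtain ⟨d, hd, hdt, hdt', hdr⟩ : ∃ d ∈ I, t ≤ d ∧ t' ≤ d ∧ r + u.length - 1 ≤ d := by
    rcases le_total t t' with h1 | h1
    · rcases le_total t' (r + u.length - 1) with h2 | h2
      · exact ⟨_, hr1, by omega, by omega, le_rfl⟩
      · exact ⟨t', ht', h1, le_rfl, h2⟩
    · rcases le_total t (r + u.length - 1) with h2 | h2
      · exact ⟨_, hr1, by omega, by omega, le_rfl⟩
      · exact ⟨t, ht, le_rfl, h1, h2⟩
  obtain ⟨n, hn⟩ : ∃ n : ℕ, (n : ℤ) = d - c + 1 := ⟨(d - c + 1).toNat, by omega⟩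
  obtain ⟨v, hvn, hv⟩ := exists_occursAt (μ := μ) (p := c) (n := n) fun k hk hk' =>
    hI.mem_of_le_of_le hc hd hk (by omega)
  -- The word `v` covers two positions of each letter and an occurrence of `u`. Its copy at `x`
  -- supplies room in front, the copy at `y` the letters, the copy at `z` the factor `u`.
  obtain ⟨x, hx, y, hy, z, hz, hxy, hyz⟩ := (h v ⟨c, hv⟩).exists_far_apart (n + 10)
  have hy' : ∀ k, c ≤ k → k ≤ d → (wordPred μ (k - c + y) ↔ wordPred μ k) := by
    intro k hck hkd
    have := OccursAt.wordPred_iff hv hy (k := (k - c).toNat) (by omega)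
    rwa [Int.toNat_of_nonneg (by omega), add_sub_cancel, add_comm] at this
  refine ⟨x, s - c + y, t - c + y, s' - c + y, t' - c + y, r - c + z,
    OccursAt.mem hx le_rfl (by omega), by omega, by omega, by omega,
    (hy' s hcs (by omega)).2 hws, (hy' t (by omega) hdt).2 hwt, by omega, by omega, by omega,
    mt (hy' s' hcs' (by omega)).1 hws', mt (hy' t' (by omega) hdt').1 hwt', ?_⟩
  refine hr.translate (fun k hk hk' => OccursAt.mem hz (by omega) (by omega)) fun k hk => ?_
  have := OccursAt.wordPred_iff hv hz (k := (r - c).toNat + k) (by omega)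
  push_cast at this
  rw [Int.toNat_of_nonneg (by omega)] at this
  convert this using 2 <;> omega

end Words

/-! ### The graph of a word and its age -/

section Main

variable {I : Set ℤ} {μ : I → Fin 2}

theorem mem_of_mem_wordVertices_of_lt {x y : ℤ} (hx : x ∈ wordVertices I)
    (hy : y ∈ wordVertices I) (hxy : x < y) : y ∈ I := by
  rcases hy with hy | hy
  · exact hy
  · rcases hx with hx | hx
    · have := hy.2 hx
      omega
    · have := hy.2 hx.1
      omega

theorem mem_wordVertices_of_mem {x : ℤ} (hx : x ∈ I) : x ∈ wordVertices I := Or.inl hx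

theorem mem_wordVertices_of_le_of_le (hI : I.OrdConnected) {x y k : ℤ} (hx : x ∈ wordVertices I)
    (hy : y ∈ wordVertices I) (hxk : x ≤ k) (hky : k ≤ y) : k ∈ wordVertices I := by
  rcases eq_or_lt_of_le hxk with rfl | hxk
  · exact hx
  have hyI := mem_of_mem_wordVertices_of_lt hx hy (by omega)
  rcases hx with hx | hx
  · exact Or.inl (hI.mem_of_le_of_le hx hyI hxk.le hky)
  · exact Or.inl (hI.mem_of_le_of_le hx.1 hyI hxk hky)

theorem wordGraph_adj_iff (x y : wordVertices I) :
    (wordGraph μ).Adj x y ↔ (chainGraph (wordPred μ)).Adj x y := by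
  have key : ∀ x y : wordVertices I, ((x : ℤ) < y ∧ ∃ h : (y : ℤ) ∈ I,
      (μ ⟨y, h⟩ = 1 ∧ (y : ℤ) = x + 1) ∨ (μ ⟨y, h⟩ = 0 ∧ (y : ℤ) ≠ x + 1)) ↔
      ((x : ℤ) < y ∧ (wordPred μ y ↔ (y : ℤ) = x + 1)) := by
    intro x y
    refine and_congr_right fun hxy => ?_
    have hy := mem_of_mem_wordVertices_of_lt x.2 y.2 hxy
    have h01 : μ ⟨y, hy⟩ = 0 ↔ ¬ μ ⟨y, hy⟩ = 1 := by omega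
    rw [wordPred_iff hy]
    simp only [hy, exists_true_left, h01]
    tauto
  rw [wordGraph, SimpleGraph.fromRel_adj, key x y, key y x]
  simp only [chainGraph]
  refine ⟨fun h => h.2, fun h => ⟨?_, h⟩⟩
  rintro rfl
  rcases h with h | h <;> exact lt_irrefl _ h.1

/-- The inclusion of `G_μ` into the chain graph on `ℤ`. -/
def wordGraphEmbedding (μ : I → Fin 2) :
    wordGraph μ ↪g chainGraph (wordPred μ) where
  toFun x := x
  inj' := Subtype.val_injective
  map_rel_iff' := (wordGraph_adj_iff _ _).symm

/-- A graph contains a segment if it contains the vertices of a translate with the same word. -/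
theorem segGraph_isIndContained_of_translate {w : ℤ → Prop} {V : Type*} {G : SimpleGraph V}
    (g : G ↪g chainGraph w) {a c : ℤ} {n : ℕ}
    (hc : ∀ i, c ≤ i → i < c + n → i ∈ Set.range g)
    (hw : ∀ k : ℕ, 0 < k → k < n → (w (c + k) ↔ w (a + k))) :
    (segGraph w a n).IsIndContained G := by
  choose e he using fun i : Fin n => hc (c + (i : ℕ)) (by omega) (by omega)
  have hlt : ∀ i j : Fin n, i < j → (G.Adj (e i) (e j) ↔ (segGraph w a n).Adj i j) := by
    intro i j hij
    have hij' : (i : ℕ) < j := hij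
    rw [← g.map_adj_iff, he, he, segGraph, SimpleGraph.comap_adj, chainGraph_adj_of_lt (by omega),
      chainGraph_adj_of_lt (by omega), hw j (by omega) j.2]
    refine iff_congr Iff.rfl ⟨fun h => by omega, fun h => by omega⟩
  refine ⟨⟨⟨e, fun i j hij => ?_⟩, fun {i j} => ?_⟩⟩
  · have := (he i).symm.trans ((congrArg g hij).trans (he j))
    exact Fin.ext (by omega)
  · rcases lt_trichotomy i j with h | rfl | h
    · exact hlt i j h
    · simp
    · have h' := hlt j i h
      rw [SimpleGraph.adj_comm, SimpleGraph.adj_comm (segGraph w a n)] at h'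
      exact h'

theorem segGraph_mem_graphAge {a : ℤ} {n : ℕ}
    (h : ∀ k, a ≤ k → k < a + n → k ∈ wordVertices I) :
    (⟨n, segGraph (wordPred μ) a n⟩ : FinGraph) ∈ graphAge (wordGraph μ) :=
  segGraph_isIndContained_of_translate (wordGraphEmbedding μ) (c := a)
    (fun i hi hin => ⟨⟨i, h i hi hin⟩, rfl⟩) fun _ _ _ => Iff.rfl

theorem isHereditary_graphAge {V : Type*} (G : SimpleGraph V) : IsHereditary (graphAge G) :=
  fun _ _ hH hGH => SimpleGraph.IsIndContained.trans hGH hH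

/-! ### Counting prime graphs -/

/-- The number of vertices of an isomorphism type of finite graphs. -/
def typeCard : Quotient finGraphIso → ℕ :=
  Quotient.lift (fun G : FinGraph => G.1) fun G H ⟨e⟩ => by
    simpa using Fintype.card_congr e.toEquiv

/-- There are finitely many graphs of each size, so infinitely many types means unbounded size. -/
theorem primeTypes_infinite_iff {C : Set FinGraph} :
    (primeTypes C).Infinite ↔ ∀ N : ℕ, ∃ G ∈ C, IsPrimeGraph G.2 ∧ N ≤ G.1 := by
  constructor
  · intro h N
    by_contra! hN
    have hfin : {G : FinGraph | G.1 < N}.Finite := by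
      refine ((Set.finite_Iio N).biUnion (t := fun n => Set.range (Sigma.mk n))
        fun n _ => Set.finite_range _).subset fun G hG => ?_
      exact Set.mem_biUnion (show G.1 ∈ Set.Iio N from hG) ⟨G.2, rfl⟩
    exact h ((hfin.subset fun G hG => hN G hG.1 hG.2).image _)
  · intro h
    refine Set.Infinite.of_image typeCard (Set.infinite_of_not_bddAbove ?_)
    rintro ⟨B, hB⟩
    obtain ⟨G, hG, hp, hGB⟩ := h (B + 1)
    have : G.1 ≤ B := hB ⟨_, ⟨G, ⟨hG, hp⟩, rfl⟩, rfl⟩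
    omega

theorem exists_block_wordVertices (hI : I.OrdConnected) (hinf : I.Infinite) (n : ℕ) :
    ∃ q : ℤ, ∀ k, q ≤ k → k < q + n → k ∈ I := by
  rcases hI.exists_block hinf with h | h <;> obtain ⟨q, -, hq⟩ := h 0 n <;> exact ⟨q, hq⟩

theorem primeTypes_graphAge_infinite (hI : I.OrdConnected) (hinf : I.Infinite) :
    (primeTypes (graphAge (wordGraph μ))).Infinite := by
  refine primeTypes_infinite_iff.2 fun N => ?_
  obtain ⟨q, hq⟩ := exists_block_wordVertices hI hinf (N + 8)
  obtain ⟨a, n, hn, hqa, han, hp⟩ := exists_isPrimeGraph_segGraph (wordPred μ) q N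
  exact ⟨⟨n, _⟩, segGraph_mem_graphAge fun k hk hk' =>
    mem_wordVertices_of_mem (hq k (by omega) (by push_cast; omega)), hp, hn⟩

/-- Every member of the age embeds in a finite segment. -/
theorem exists_segGraph_of_mem_graphAge (hI : I.OrdConnected) (hinf : I.Infinite) {G : FinGraph}
    (hG : G ∈ graphAge (wordGraph μ)) :
    ∃ (a : ℤ) (n : ℕ), 0 < n ∧ (∀ k, a ≤ k → k < a + n → k ∈ wordVertices I) ∧
      G.2.IsIndContained (segGraph (wordPred μ) a n) := by
  obtain ⟨g⟩ := hG
  obtain ⟨x, hx⟩ := hinf.nonempty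
  set S : Finset ℤ := insert x (Finset.univ.image fun i => ((g i : wordVertices I) : ℤ)) with hS
  have hSne : S.Nonempty := ⟨x, Finset.mem_insert_self _ _⟩
  have hSV : ∀ y ∈ S, y ∈ wordVertices I := by
    intro y hy
    rcases Finset.mem_insert.1 hy with rfl | hy
    · exact Or.inl hx
    · obtain ⟨i, -, rfl⟩ := Finset.mem_image.1 hy
      exact (g i).2
  have hgS : ∀ i, ((g i : wordVertices I) : ℤ) ∈ S := fun i =>
    Finset.mem_insert_of_mem (Finset.mem_image_of_mem _ (Finset.mem_univ i))
  have hle := S.min'_le_max' hSne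
  set a := S.min' hSne with ha
  set b := S.max' hSne with hb
  refine ⟨a, (b - a + 1).toNat, by omega, fun k hk hk' => ?_, ?_⟩
  · exact mem_wordVertices_of_le_of_le hI (hSV _ (S.min'_mem hSne)) (hSV _ (S.max'_mem hSne)) hk
      (by omega)
  · have h1 : ∀ i, a ≤ (g i : ℤ) := fun i => S.min'_le _ (hgS i)
    have h2 : ∀ i, (g i : ℤ) ≤ b := fun i => S.le_max' _ (hgS i)
    refine ⟨⟨⟨fun i => ⟨((g i : ℤ) - a).toNat, by have := h1 i; have := h2 i; omega⟩,
      fun i j hij => ?_⟩, fun {i j} => ?_⟩⟩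
    · have h3 := h1 i
      have h4 := h1 j
      have h5 : ((g i : ℤ) - a).toNat = ((g j : ℤ) - a).toNat := congrArg Fin.val hij
      exact g.injective (Subtype.ext (by omega))
    · have h3 : ∀ i, a + (((g i : ℤ) - a).toNat : ℕ) = g i := fun i => by
        have := h1 i
        omega
      rw [← g.map_adj_iff, wordGraph_adj_iff]
      change (chainGraph (wordPred μ)).Adj (a + (((g i : ℤ) - a).toNat : ℕ))
        (a + (((g j : ℤ) - a).toNat : ℕ)) ↔ _
      rw [h3, h3]

/-! ### The two implications -/

theorem IsUniformlyRecurrent.isMinimalPrimeClass (hI : I.OrdConnected) (hinf : I.Infinite)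
    (h : IsUniformlyRecurrent μ) : IsMinimalPrimeClass (graphAge (wordGraph μ)) := by
  refine ⟨isHereditary_graphAge _, primeTypes_graphAge_infinite hI hinf, fun D hD hDC => ?_⟩
  by_contra hDinf
  obtain ⟨H, hH, hHD⟩ := Set.exists_of_ssubset hDC
  obtain ⟨a, n, hn, haV, hHa⟩ := exists_segGraph_of_mem_graphAge hI hinf hH
  have haI : ∀ k, a + 1 ≤ k → k < a + 1 + (n - 1 : ℕ) → k ∈ I := fun k hk hk' =>
    mem_of_mem_wordVertices_of_lt (haV a le_rfl (by omega)) (haV k (by omega) (by omega))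
      (by omega)
  obtain ⟨u, hun, hu⟩ := exists_occursAt (μ := μ) haI
  obtain ⟨m, hm⟩ := isUniformlyRecurrent_iff.1 h u ⟨_, hu⟩
  -- One vertex may be lost from the run in the image, and the first vertex of the run carries no
  -- usable letter; `m` letters remain.
  obtain ⟨G, hG, hGp, hGm⟩ := primeTypes_infinite_iff.1 hDinf (m + 2)
  obtain ⟨f⟩ := hDC.1 hG
  let g : G.2 ↪g chainGraph (wordPred μ) := (wordGraphEmbedding μ).comp f
  obtain ⟨c, hc⟩ := hGp.exists_segment_subset_range (by omega) g
  have hcV : ∀ i, c ≤ i → i < c + G.1 - 1 → i ∈ wordVertices I := by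
    intro i hi hi'
    obtain ⟨x, rfl⟩ := hc i hi hi'
    exact (f x).2
  obtain ⟨p, hcp, hpm, hp⟩ := hm (c + 1) fun k hk hk' => mem_of_mem_wordVertices_of_lt
    (hcV c le_rfl (by omega)) (hcV k (by omega) (by omega)) (by omega)
  refine hHD (hD H G hG (hHa.trans (segGraph_isIndContained_of_translate g (c := p - 1)
    (fun i hi hi' => hc i (by omega) (by omega)) fun k hk hkn => ?_)))
  have := OccursAt.wordPred_iff hu hp (k := k - 1) (by omega)
  convert this using 2 <;> omega

/-- The graphs that embed in a finite segment in which `u` does not occur. -/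
def avoidingClass (μ : I → Fin 2) (u : List (Fin 2)) : Set FinGraph :=
  {H | ∃ (c : ℤ) (n : ℕ), (∀ k, c ≤ k → k < c + n → k ∈ wordVertices I) ∧
    (∀ p, c < p → p + u.length ≤ c + n → ¬ OccursAt μ u p) ∧
    H.2.IsIndContained (segGraph (wordPred μ) c n)}

theorem isHereditary_avoidingClass (μ : I → Fin 2) (u : List (Fin 2)) :
    IsHereditary (avoidingClass μ u) :=
  fun _ _ ⟨c, n, hV, hu, hH⟩ hGH => ⟨c, n, hV, hu, hGH.trans hH⟩

theorem avoidingClass_subset_graphAge (u : List (Fin 2)) :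
    avoidingClass μ u ⊆ graphAge (wordGraph μ) :=
  fun _ ⟨_, _, hV, _, hH⟩ => hH.trans (segGraph_mem_graphAge hV)

theorem primeTypes_avoidingClass_infinite {u : List (Fin 2)}
    (h : ∀ m : ℕ, ∃ q : ℤ, (∀ k, q ≤ k → k < q + m → k ∈ I) ∧
      ∀ p, q ≤ p → p + u.length ≤ q + m → ¬ OccursAt μ u p) :
    (primeTypes (avoidingClass μ u)).Infinite := by
  refine primeTypes_infinite_iff.2 fun N => ?_
  obtain ⟨q, hq, hqu⟩ := h (N + 8)
  obtain ⟨a, n, hn, hqa, han, hp⟩ := exists_isPrimeGraph_segGraph (wordPred μ) q N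
  refine ⟨⟨n, _⟩, ⟨a, n, fun k hk hk' => mem_wordVertices_of_mem
    (hq k (by omega) (by push_cast; omega)), fun p hap hpn => hqu p (by omega)
    (by push_cast; omega), SimpleGraph.IsIndContained.refl _⟩, hp, hn⟩

/-- A segment that contains two occurrences of each letter and then `u` does not embed in a segment
in which `u` does not occur. -/
theorem segGraph_notMem_avoidingClass {u : List (Fin 2)} {a s t s' t' q : ℤ}
    {n : ℕ} (hs : a + 6 ≤ s) (hst : s < t) (ht : t + 2 ≤ q) (hws : wordPred μ s)
    (hwt : wordPred μ t) (hs' : a + 6 ≤ s') (hst' : s' < t') (ht' : t' + 2 ≤ q)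
    (hws' : ¬ wordPred μ s') (hwt' : ¬ wordPred μ t') (hu : OccursAt μ u q)
    (hu0 : 0 < u.length) (hn : a + n = q + u.length) :
    (⟨n, segGraph (wordPred μ) a n⟩ : FinGraph) ∉ avoidingClass μ u := by
  rintro ⟨c, m, hV, hcu, ⟨(g : segGraph (wordPred μ) a n ↪g segGraph (wordPred μ) c m)⟩⟩
  have hn0 : 0 < n := by omega
  -- The clamping only makes `f` total; on the segment it is `g` in integer coordinates.
  let f : ℤ → ℤ := fun x => c + (g ⟨min (x - a).toNat (n - 1), by omega⟩ : ℕ)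
  have hval : ∀ x ∈ Set.Icc a (a + n - 1), a + ((min (x - a).toNat (n - 1) : ℕ) : ℤ) = x := by
    intro x hx
    obtain ⟨h1, h2⟩ := hx
    omega
  have hinj : Set.InjOn f (Set.Icc a (a + n - 1)) := by
    intro x hx y hy hxy
    have h1 := Fin.mk.inj_iff.1 (g.injective (Fin.ext (by simpa [f] using hxy)))
    have h2 := hval x hx
    have h3 := hval y hy
    omega
  have hf : ∀ x ∈ Set.Icc a (a + n - 1), ∀ y ∈ Set.Icc a (a + n - 1),
      ((chainGraph (wordPred μ)).Adj (f x) (f y) ↔ (chainGraph (wordPred μ)).Adj x y) := by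
    intro x hx y hy
    have h := g.map_adj_iff (v := ⟨min (x - a).toNat (n - 1), by omega⟩)
      (w := ⟨min (y - a).toNat (n - 1), by omega⟩)
    simp only [segGraph, SimpleGraph.comap_adj, hval x hx, hval y hy] at h
    exact h
  have hrange : ∀ x, c ≤ f x ∧ f x < c + m := fun x => by
    have := (g ⟨min (x - a).toNat (n - 1), by omega⟩).2
    simp only [f]
    omega
  have htr : ∀ i, q ≤ i → i ≤ a + n - 1 →
      f (i - 1) = f i - 1 ∧ (wordPred μ (f i) ↔ wordPred μ i) := fun i hi hin =>
    translation_of_embedding hinj hf hst hs (by omega) hws hwt hst' hs' (by omega) hws' hwt' hi hin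
  have hfk : ∀ k : ℕ, k < u.length → f (q + k) = f q + k := by
    intro k hk
    induction k with
    | zero => simp
    | succ k ih =>
      have h1 := ih (by omega)
      have h2 := (htr (q + (k + 1 : ℕ)) (by omega) (by omega)).1
      have h3 : q + ((k + 1 : ℕ) : ℤ) - 1 = q + k := by push_cast; ring
      rw [h3] at h2
      push_cast at h2 ⊢
      omega
  have hlast := hfk (u.length - 1) (by omega)
  -- The image of `q - 1` is `f q - 1` and lies in the target segment, which gives the strict
  -- inequality `c < f q` required by `avoidingClass`.
  have hfirst := (htr q le_rfl (by omega)).1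
  have h1 := hrange (q + (u.length - 1 : ℕ))
  have h2 := hrange (q - 1)
  refine hcu (f q) (by omega) (by omega) (hu.translate (fun k hk hk' => ?_) fun k hk => ?_)
  · exact mem_of_mem_wordVertices_of_lt (hV c le_rfl (by omega)) (hV k (by omega) (by omega))
      (by omega)
  · rw [← hfk k hk]
    exact (htr (q + k) (by omega) (by omega)).2

theorem IsRecurrent.isUniformlyRecurrent (hI : I.OrdConnected) (h : IsRecurrent μ)
    (hmin : IsMinimalPrimeClass (graphAge (wordGraph μ))) : IsUniformlyRecurrent μ := by
  by_contra hur
  obtain ⟨p₁, hp₁, p₂, hp₂, h₁, h₂⟩ :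
      ∃ p₁ ∈ I, ∃ p₂ ∈ I, wordPred μ p₁ ∧ ¬ wordPred μ p₂ := by
    by_contra! hc
    exact hur (isUniformlyRecurrent_of_const fun p hp q hq => ⟨hc p hp q hq, hc q hq p hp⟩)
  rw [isUniformlyRecurrent_iff] at hur
  push Not at hur
  obtain ⟨u, hu, hgap⟩ := hur
  have hu0 : 0 < u.length := by
    by_contra hu0
    obtain ⟨q, -, hq⟩ := hgap 0
    exact hq q le_rfl (by omega) fun k hk => by omega
  obtain ⟨a, s, t, s', t', q, ha, hs, hst, ht, hws, hwt, hs', hst', ht', hws', hwt', hq⟩ :=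
    h.exists_preceded hI hp₁ hp₂ h₁ h₂ hu hu0
  obtain ⟨n, hn⟩ : ∃ n : ℕ, a + n = q + u.length := ⟨(q + u.length - a).toNat, by omega⟩
  have hmem : (⟨n, segGraph (wordPred μ) a n⟩ : FinGraph) ∈ graphAge (wordGraph μ) :=
    segGraph_mem_graphAge fun k hk hk' => mem_wordVertices_of_mem
      (hI.mem_of_le_of_le ha (hq.mem (k := q + u.length - 1) (by omega) (by omega)) hk (by omega))
  have hnot := segGraph_notMem_avoidingClass hs hst ht hws hwt hs' hst' ht' hws' hwt' hq hu0 hn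
  have hss : avoidingClass μ u ⊂ graphAge (wordGraph μ) :=
    (Set.ssubset_iff_of_subset (avoidingClass_subset_graphAge u)).2 ⟨_, hmem, hnot⟩
  exact primeTypes_avoidingClass_infinite hgap
    (hmin.2.2 _ (isHereditary_avoidingClass μ u) hss)

end Main

theorem mainTheorem2 (I : Set ℤ) (hI : I.OrdConnected) (hinf : I.Infinite) (μ : I → Fin 2) :
    IsUniformlyRecurrent μ ↔ IsRecurrent μ ∧ IsMinimalPrimeClass (graphAge (wordGraph μ)) :=
  ⟨fun h => ⟨h.isRecurrent hI hinf, h.isMinimalPrimeClass hI hinf⟩,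
    fun h => h.1.isUniformlyRecurrent hI h.2⟩
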